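/- For an $n\times n$ complex matrix $Z$ let $|Z|=(Z^*Z)^{1/2}$ and $|Z|_{\mathrm{sym}}=\tfrac12(|Z|+|Z^*|)$, and let $\|X\|_p=(\operatorname{tr}|X|^p)^{1/p}$ for $1\le p<\infty$ and $\|X\|_\infty$ the operator norm. For integers $m,n\ge 1$ and $1\le p\le\infty$ there is a smallest real constant $c_p^{\mathrm{sym}}(m,n)$ such that $$\Bigl\|\Bigl|\sum_{k=1}^m A_k\Bigr|_{\mathrm{sym}}\Bigr\|_p\le c_p^{\mathrm{sym}}(m,n)\,\Bigl\|\sum_{k=1}^m|A_k|_{\mathrm{sym}}\Bigr\|_p$$ for all $n\times n$ complex matrices $A_1,\dots,A_m$, and it has the following properties. 1. $c_1^{\mathrm{sym}}(m,n)=1$ for all $m,n\ge1$. 2. $c_\infty^{\mathrm{sym}}(m,n)=\sqrt2$ for $m\ge2$ and $n\ge3$. 3. $c_p^{\mathrm{sym}}(m,n)\le\min\{2^{1-1/p},\sqrt2\}$ for all $m,n\ge1$ and $1\le p\le\infty$ (with $1/\infty=0$). 4. For $1\le p<\infty$, $$c_p^{\mathrm{sym}}(m,n)\ge\left(\frac{2^{p/2}+2^{1-p/2}}{3}\right)^{1/p}$$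 whenever $m\ge2$ and $n\ge3$, and also for all $m,n\ge1$ if $p\le2$. The right-hand side, as a function of real $p$, equals $1$ at $p=2$, is strictly increasing on $[2,\infty)$, and tends to $\sqrt2$ as $p\to\infty$. -/

import Mathlib

open scoped MatrixOrder ENNReal Topology

noncomputable section

/-- The usual modulus `|Z| = (Zᴴ Z)^{1/2}` of a complex square matrix. -/
def usualModulus {n : ℕ} (Z : Matrix (Fin n) (Fin n) ℂ) : Matrix (Fin n) (Fin n) ℂ :=
  CFC.abs Z

/-- The arithmetic symmetric modulus `|Z|_sym = (|Z| + |Zᴴ|) / 2`. -/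
def symModulus {n : ℕ} (Z : Matrix (Fin n) (Fin n) ℂ) : Matrix (Fin n) (Fin n) ℂ :=
  (2 : ℂ)⁻¹ • (usualModulus Z + usualModulus Z.conjTranspose)

/-- The Schatten `p`-norm (used for `1 ≤ p ≤ ∞`): `(tr |X|^p)^{1/p}` for finite `p`, and the operator
norm on Euclidean space for `p = ∞`. The trace of the positive semidefinite matrix `|X|^p` is a
nonnegative real number, so taking its real part loses nothing. -/
def schattenNorm {n : ℕ} (p : ℝ≥0∞) (X : Matrix (Fin n) (Fin n) ℂ) : ℝ :=
  if p = ∞ then ‖Matrix.toEuclideanCLM (n := Fin n) (𝕜 := ℂ) X‖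
  else (CFC.rpow (usualModulus X) p.toReal).trace.re ^ (1 / p.toReal)

/-- The real constants `c` with `‖|∑ A_k|_sym‖_p ≤ c ‖∑ |A_k|_sym‖_p` for all `n × n` complex
matrices `A_1, …, A_m`. -/
def symConstantSet (p : ℝ≥0∞) (m n : ℕ) : Set ℝ :=
  {c | ∀ A : Fin m → Matrix (Fin n) (Fin n) ℂ,
    schattenNorm p (symModulus (∑ k, A k)) ≤ c * schattenNorm p (∑ k, symModulus (A k))}

/-- The optimal constant `c_p^sym(m, n)`. -/
def symConstant (p : ℝ≥0∞) (m n : ℕ) : ℝ :=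
  sInf (symConstantSet p m n)

/-- The function `((2^{p/2} + 2^{1 - p/2}) / 3)^{1/p}` of a real exponent `p`. -/
def symLowerBound (p : ℝ) : ℝ :=
  (((2 : ℝ) ^ (p / 2) + (2 : ℝ) ^ (1 - p / 2)) / 3) ^ (1 / p)

end

/-! Write `S = ∑ A_k`, `Y = ∑ |A_k|`, `X = ∑ |A_kᴴ|`, `H = ∑ |A_k|_sym`, so `X + Y = 2H`. Polar
decomposition gives `Wᴴ A + Aᴴ W ≤ t |A| + t⁻¹ Wᴴ |Aᴴ| W` for unitary `W` and `t > 0`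
(`add_conj_sub_posSemidef`). Summing over `k` with `W` the polar factor of `S` bounds `2|S|`; the
adjoint family bounds `2|Sᴴ|`. Averaging and taking norms (`schattenNorm_symModulus_sum_le`),
`‖|S|_sym‖ ≤ (t/2) ‖H‖ + (1/(4t)) (‖X‖ + ‖Y‖)`. Since `X, Y ≤ 2H`, the choice `t = √2` yields the
constant `√2`. For `p ≤ 2`, McCarthy's inequality improves the bound on `‖X‖ + ‖Y‖`, and `t = 1`
yields `2^{1-1/p}`.

For the lower bounds, `exists_extremal_pair` gives two rank-one matrices whose symmetric moduli sum
to a rank-three projection, while their sum has symmetric modulus with nonzero eigenvalues `√2,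
1/√2, 1/√2`. The bound `1` comes from a single identity matrix. -/

open scoped ComplexOrder

/-! ### Traces of powers and diagonals in orthonormal bases -/

section SpectralTrace

variable {n : ℕ}

/-- The trace of `f(X)` is the sum of `f` over the eigenvalues of `X`. -/
theorem trace_cfc_re {X : Matrix (Fin n) (Fin n) ℂ} (hX : X.IsHermitian) (f : ℝ → ℝ) :
    (cfc f X).trace.re = ∑ i, f (hX.eigenvalues i) := by
  rw [hX.cfc_eq, Matrix.IsHermitian.cfc, Unitary.conjStarAlgAut_apply, Matrix.trace_mul_cycle]
  simp [Matrix.trace]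

theorem trace_rpow_re {X : Matrix (Fin n) (Fin n) ℂ} (hX : X.PosSemidef) (p : ℝ) :
    (CFC.rpow X p).trace.re = ∑ i, hX.isHermitian.eigenvalues i ^ p := by
  have h := CFC.rpow_eq_cfc_real (a := X) (y := p) (Matrix.nonneg_iff_posSemidef.mpr hX)
  change CFC.rpow X p = _ at h
  rw [h, trace_cfc_re hX.isHermitian]

theorem usualModulus_of_posSemidef {X : Matrix (Fin n) (Fin n) ℂ} (hX : X.PosSemidef) :
    usualModulus X = X :=
  CFC.abs_of_nonneg X (Matrix.nonneg_iff_posSemidef.mpr hX)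

theorem usualModulus_posSemidef (X : Matrix (Fin n) (Fin n) ℂ) : (usualModulus X).PosSemidef :=
  Matrix.nonneg_iff_posSemidef.mp (CFC.abs_nonneg X)

open Matrix in
/-- A diagonal entry of a Hermitian matrix in another orthonormal basis is an average of the
eigenvalues. -/
theorem conj_apply_re {X V : Matrix (Fin n) (Fin n) ℂ} (hX : X.IsHermitian) (i : Fin n) :
    ((Vᴴ * X * V) i i).re =
      ∑ j, ‖((Vᴴ * (hX.eigenvectorUnitary : Matrix (Fin n) (Fin n) ℂ)) i j)‖ ^ 2 *
        hX.eigenvalues j := by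
  set U : Matrix (Fin n) (Fin n) ℂ := hX.eigenvectorUnitary.1
  have h : Vᴴ * X * V = (Vᴴ * U) * diagonal (fun j => (hX.eigenvalues j : ℂ)) * (Vᴴ * U)ᴴ := by
    conv_lhs => rw [hX.spectral_theorem, Unitary.conjStarAlgAut_apply]
    simp only [Matrix.conjTranspose_mul, Matrix.conjTranspose_conjTranspose, Matrix.mul_assoc]
    rfl
  rw [h, Matrix.mul_apply, Complex.re_sum]
  refine Finset.sum_congr rfl fun j _ => ?_
  rw [Matrix.mul_diagonal, Matrix.conjTranspose_apply, mul_right_comm, Complex.star_def,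
    Complex.mul_conj, Complex.normSq_eq_norm_sq]
  norm_cast

theorem sum_norm_sq_row {W : Matrix (Fin n) (Fin n) ℂ} (hW : W ∈ Matrix.unitaryGroup (Fin n) ℂ)
    (i : Fin n) : ∑ j, ‖W i j‖ ^ 2 = 1 := by
  have h := congr_fun₂ (Matrix.mem_unitaryGroup_iff.mp hW) i i
  simp only [Matrix.mul_apply, Matrix.star_apply, Complex.star_def, Complex.mul_conj,
    Complex.normSq_eq_norm_sq, Matrix.one_apply_eq] at h
  exact_mod_cast h

theorem sum_norm_sq_col {W : Matrix (Fin n) (Fin n) ℂ} (hW : W ∈ Matrix.unitaryGroup (Fin n) ℂ)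
    (j : Fin n) : ∑ i, ‖W i j‖ ^ 2 = 1 := by
  have h := sum_norm_sq_row (Unitary.star_mem hW) j
  simpa [Matrix.star_apply] using h

/-- **Peierls' inequality** for powers: passing to the diagonal in any orthonormal basis decreases
`tr X^p`. -/
theorem sum_conj_rpow_le {X V : Matrix (Fin n) (Fin n) ℂ} (hX : X.PosSemidef)
    (hV : V ∈ Matrix.unitaryGroup (Fin n) ℂ) {p : ℝ} (hp : 1 ≤ p) :
    ∑ i, ((V.conjTranspose * X * V) i i).re ^ p ≤ (CFC.rpow X p).trace.re := by
  set W := V.conjTranspose * (hX.isHermitian.eigenvectorUnitary : Matrix (Fin n) (Fin n) ℂ) with hW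
  have hWu : W ∈ Matrix.unitaryGroup (Fin n) ℂ :=
    mul_mem (Unitary.star_mem hV) hX.isHermitian.eigenvectorUnitary.2
  rw [trace_rpow_re hX]
  calc ∑ i, ((V.conjTranspose * X * V) i i).re ^ p
      ≤ ∑ i, ∑ j, ‖W i j‖ ^ 2 * hX.isHermitian.eigenvalues j ^ p := by
        refine Finset.sum_le_sum fun i _ => ?_
        -- The weights `‖W i j‖ ^ 2` are doubly stochastic: row sums allow Jensen here, column sums
        -- collapse the double sum afterwards.
        rw [conj_apply_re hX.isHermitian]
        exact Real.rpow_arith_mean_le_arith_mean_rpow _ _ _ (fun j _ => by positivity)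
          (sum_norm_sq_row hWu i) (fun j _ => hX.eigenvalues_nonneg j) hp
    _ = ∑ j, hX.isHermitian.eigenvalues j ^ p := by
        rw [Finset.sum_comm]
        refine Finset.sum_congr rfl fun j _ => ?_
        rw [← Finset.sum_mul, sum_norm_sq_col hWu, one_mul]

/-- The equality case of Peierls, attained in an eigenbasis. Norm inequalities follow by
diagonalising the smaller side and using Peierls on the larger one. -/
theorem exists_unitary_trace_rpow {X : Matrix (Fin n) (Fin n) ℂ} (hX : X.PosSemidef) (p : ℝ) :
    ∃ V ∈ Matrix.unitaryGroup (Fin n) ℂ,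
      (CFC.rpow X p).trace.re = ∑ i, ((V.conjTranspose * X * V) i i).re ^ p := by
  refine ⟨_, hX.isHermitian.eigenvectorUnitary.2, ?_⟩
  rw [trace_rpow_re hX]
  refine Finset.sum_congr rfl fun i _ => ?_
  rw [conj_apply_re hX.isHermitian]
  have h : (hX.isHermitian.eigenvectorUnitary : Matrix (Fin n) (Fin n) ℂ).conjTranspose *
      (hX.isHermitian.eigenvectorUnitary : Matrix (Fin n) (Fin n) ℂ) = 1 :=
    Unitary.coe_star_mul_self _
  rw [h, Finset.sum_eq_single i] <;> simp +contextual [eq_comm]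

theorem conj_apply_re_nonneg {X : Matrix (Fin n) (Fin n) ℂ} (hX : X.PosSemidef)
    (V : Matrix (Fin n) (Fin n) ℂ) (i : Fin n) : 0 ≤ ((V.conjTranspose * X * V) i i).re :=
  (Complex.le_def.mp ((hX.conjTranspose_mul_mul_same V).diag_nonneg (i := i))).1

end SpectralTrace

/-! ### Schatten norms of positive semidefinite matrices -/

section SchattenNorm

variable {n : ℕ} {p : ℝ≥0∞}

theorem schattenNorm_eq_rpow {X : Matrix (Fin n) (Fin n) ℂ} (hX : X.PosSemidef) (hp : p ≠ ∞) :
    schattenNorm p X = (CFC.rpow X p.toReal).trace.re ^ (1 / p.toReal) := by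
  rw [schattenNorm, if_neg hp, usualModulus_of_posSemidef hX]

theorem trace_rpow_re_nonneg {X : Matrix (Fin n) (Fin n) ℂ} (hX : X.PosSemidef) (q : ℝ) :
    0 ≤ (CFC.rpow X q).trace.re := by
  rw [trace_rpow_re hX]
  exact Finset.sum_nonneg fun i _ => Real.rpow_nonneg (hX.eigenvalues_nonneg i) _

theorem schattenNorm_nonneg (p : ℝ≥0∞) (X : Matrix (Fin n) (Fin n) ℂ) : 0 ≤ schattenNorm p X := by
  rw [schattenNorm]
  split_ifs
  · exact norm_nonneg _
  · exact Real.rpow_nonneg (trace_rpow_re_nonneg (usualModulus_posSemidef X) _) _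

open scoped Matrix.Norms.L2Operator in
theorem schattenNorm_top (X : Matrix (Fin n) (Fin n) ℂ) : schattenNorm ∞ X = ‖X‖ := by
  rw [schattenNorm, if_pos rfl, Matrix.cstar_norm_def]

theorem one_le_toReal (h1 : 1 ≤ p) (hp : p ≠ ∞) : 1 ≤ p.toReal := by
  simpa using (ENNReal.toReal_le_toReal ENNReal.one_ne_top hp).mpr h1

open scoped Matrix.Norms.L2Operator in
/-- Monotonicity and the triangle inequality for the Schatten norm on positive semidefinite
matrices. -/
theorem schattenNorm_le_add (h1 : 1 ≤ p) {X Y Z : Matrix (Fin n) (Fin n) ℂ} (hX : X.PosSemidef)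
    (hY : Y.PosSemidef) (hZ : Z.PosSemidef) (h : Z ≤ X + Y) :
    schattenNorm p Z ≤ schattenNorm p X + schattenNorm p Y := by
  by_cases hp : p = ∞
  · subst hp
    simp only [schattenNorm_top]
    exact (CStarAlgebra.norm_le_norm_of_nonneg_of_le
      (Matrix.nonneg_iff_posSemidef.mpr hZ) h).trans (norm_add_le _ _)
  have hp1 := one_le_toReal h1 hp
  rw [schattenNorm_eq_rpow hX hp, schattenNorm_eq_rpow hY hp, schattenNorm_eq_rpow hZ hp]
  obtain ⟨V, hV, hVZ⟩ := exists_unitary_trace_rpow hZ p.toReal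
  rw [hVZ]
  have hle (i : Fin n) : ((V.conjTranspose * Z * V) i i).re ≤
      ((V.conjTranspose * X * V) i i).re + ((V.conjTranspose * Y * V) i i).re := by
    have := conj_apply_re_nonneg (Matrix.le_iff.mp h) V i
    simp only [Matrix.mul_sub, Matrix.sub_mul, Matrix.mul_add, Matrix.add_mul, Matrix.sub_apply,
      Matrix.add_apply, Complex.sub_re, Complex.add_re] at this
    linarith
  calc _ ≤ (∑ i, (((V.conjTranspose * X * V) i i).re +
        ((V.conjTranspose * Y * V) i i).re) ^ p.toReal) ^ (1 / p.toReal) := by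
        gcongr with i
        · exact Finset.sum_nonneg fun i _ => Real.rpow_nonneg (conj_apply_re_nonneg hZ V i) _
        · exact conj_apply_re_nonneg hZ V i
        · exact hle i
    _ ≤ _ := Real.Lp_add_le_of_nonneg _ hp1 (fun i _ => conj_apply_re_nonneg hX V i)
        (fun i _ => conj_apply_re_nonneg hY V i)
    _ ≤ _ := by
        gcongr
        · exact Finset.sum_nonneg fun i _ => Real.rpow_nonneg (conj_apply_re_nonneg hX V i) _
        · exact sum_conj_rpow_le hX hV hp1
        · exact Finset.sum_nonneg fun i _ => Real.rpow_nonneg (conj_apply_re_nonneg hY V i) _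
        · exact sum_conj_rpow_le hY hV hp1

open scoped Matrix.Norms.L2Operator in
theorem schattenNorm_conj_unitary_le (h1 : 1 ≤ p) {X W : Matrix (Fin n) (Fin n) ℂ}
    (hX : X.PosSemidef) (hW : W ∈ Matrix.unitaryGroup (Fin n) ℂ) :
    schattenNorm p (W.conjTranspose * X * W) ≤ schattenNorm p X := by
  by_cases hp : p = ∞
  · subst hp
    simp only [schattenNorm_top]
    rw [CStarRing.norm_mul_mem_unitary _ hW]
    exact (CStarRing.norm_mem_unitary_mul X (Unitary.star_mem hW)).le
  have hp1 := one_le_toReal h1 hp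
  have hZ := hX.conjTranspose_mul_mul_same W
  rw [schattenNorm_eq_rpow hX hp, schattenNorm_eq_rpow hZ hp]
  obtain ⟨V, hV, hVZ⟩ := exists_unitary_trace_rpow hZ p.toReal
  have h := sum_conj_rpow_le hX (mul_mem hW hV) hp1
  have h' : (W * V).conjTranspose * X * (W * V) =
      V.conjTranspose * (W.conjTranspose * X * W) * V := by
    simp only [Matrix.conjTranspose_mul, Matrix.mul_assoc]
  rw [h', ← hVZ] at h
  exact Real.rpow_le_rpow (trace_rpow_re_nonneg hZ _) h (by positivity)

open scoped Matrix.Norms.L2Operator in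
theorem schattenNorm_smul_le (h1 : 1 ≤ p) {X : Matrix (Fin n) (Fin n) ℂ} (hX : X.PosSemidef)
    {c : ℝ} (hc : 0 ≤ c) : schattenNorm p (c • X) ≤ c * schattenNorm p X := by
  by_cases hp : p = ∞
  · subst hp
    simp only [schattenNorm_top]
    rw [norm_smul, Real.norm_of_nonneg hc]
  have hp1 := one_le_toReal h1 hp
  have hZ : (c • X).PosSemidef := hX.smul hc
  rw [schattenNorm_eq_rpow hX hp, schattenNorm_eq_rpow hZ hp]
  obtain ⟨V, hV, hVZ⟩ := exists_unitary_trace_rpow hZ p.toReal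
  have h := sum_conj_rpow_le hX hV hp1
  have h2 : (CFC.rpow (c • X) p.toReal).trace.re ≤
      c ^ p.toReal * (CFC.rpow X p.toReal).trace.re := by
    rw [hVZ]
    refine le_trans (le_of_eq ?_) (mul_le_mul_of_nonneg_left h (by positivity))
    rw [Finset.mul_sum]
    refine Finset.sum_congr rfl fun i _ => ?_
    rw [← Real.mul_rpow hc (conj_apply_re_nonneg hX V i)]
    simp
  calc _ ≤ (c ^ p.toReal * (CFC.rpow X p.toReal).trace.re) ^ (1 / p.toReal) :=
        Real.rpow_le_rpow (trace_rpow_re_nonneg hZ _) h2 (by positivity)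
    _ = _ := by
        rw [Real.mul_rpow (by positivity) (trace_rpow_re_nonneg hX _), ← Real.rpow_mul hc,
          mul_one_div_cancel (by positivity), Real.rpow_one]

theorem trace_mul_re_nonneg {X Y : Matrix (Fin n) (Fin n) ℂ} (hX : X.PosSemidef)
    (hY : Y.PosSemidef) : 0 ≤ (X * Y).trace.re := by
  obtain ⟨B, rfl⟩ := CStarAlgebra.nonneg_iff_eq_star_mul_self.mp hX.nonneg
  rw [Matrix.mul_assoc, Matrix.trace_mul_comm]
  exact (Complex.le_def.mp (hY.mul_mul_conjTranspose_same B).trace_nonneg).1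

open scoped Matrix.Norms.L2Operator in
theorem rpow_le_rpow_of_le {X Y : Matrix (Fin n) (Fin n) ℂ} (h : X ≤ Y) {q : ℝ}
    (hq : q ∈ Set.Icc (0 : ℝ) 1) : CFC.rpow X q ≤ CFC.rpow Y q :=
  CFC.rpow_le_rpow hq h

-- As `q - 1 > 0`, the exponents add even when `X` is singular.
open scoped Matrix.Norms.L2Operator in
theorem rpow_eq_mul_rpow {X : Matrix (Fin n) (Fin n) ℂ} (hX : X.PosSemidef) {q : ℝ} (hq : 1 < q) :
    CFC.rpow X q = X * CFC.rpow X (q - 1) := by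
  have hX' : 0 ≤ X := Matrix.nonneg_iff_posSemidef.mpr hX
  have hpos : 0 < (q - 1).toNNReal := by simpa using hq
  have h := CFC.nnrpow_add (a := X) one_pos hpos
  rw [CFC.nnrpow_one X hX', CFC.nnrpow_eq_rpow hpos, CFC.nnrpow_eq_rpow (by positivity)] at h
  have e : ((q - 1).toNNReal : ℝ) = q - 1 := Real.coe_toNNReal _ (by linarith)
  rw [NNReal.coe_add, e] at h
  simpa using h

/-- **McCarthy's inequality** for exponents in `[1, 2]`. -/
theorem trace_rpow_add_le {X Y : Matrix (Fin n) (Fin n) ℂ} (hX : X.PosSemidef) (hY : Y.PosSemidef)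
    {q : ℝ} (hq1 : 1 ≤ q) (hq2 : q ≤ 2) :
    (CFC.rpow X q).trace.re + (CFC.rpow Y q).trace.re ≤ (CFC.rpow (X + Y) q).trace.re := by
  have hXY := hX.add hY
  rcases hq1.eq_or_lt with rfl | hq
  · have h1 {Z : Matrix (Fin n) (Fin n) ℂ} (hZ : Z.PosSemidef) : CFC.rpow Z (1 : ℝ) = Z :=
      CFC.rpow_one Z (Matrix.nonneg_iff_posSemidef.mpr hZ)
    rw [h1 hX, h1 hY, h1 hXY, Matrix.trace_add, Complex.add_re]
  -- Here `q ≤ 2` enters: `x ↦ x^(q-1)` is operator monotone, so `tr X^q = tr (X · X^(q-1)) ≤ tr (X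
  -- (X+Y)^(q-1))`, and likewise for `Y`.
  have hI : q - 1 ∈ Set.Icc (0 : ℝ) 1 := ⟨by linarith, by linarith⟩
  have key {Z : Matrix (Fin n) (Fin n) ℂ} (hZ : Z.PosSemidef) (hle : Z ≤ X + Y) :
      (CFC.rpow Z q).trace.re ≤ (Z * CFC.rpow (X + Y) (q - 1)).trace.re := by
    have := trace_mul_re_nonneg hZ (Matrix.le_iff.mp (rpow_le_rpow_of_le hle hI))
    rw [Matrix.mul_sub, Matrix.trace_sub, Complex.sub_re] at this
    rw [rpow_eq_mul_rpow hZ hq]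
    linarith
  have h1 := key hX (by simpa using Matrix.nonneg_iff_posSemidef.mpr hY)
  have h2 := key hY (by simpa using Matrix.nonneg_iff_posSemidef.mpr hX)
  rw [rpow_eq_mul_rpow hXY hq, Matrix.add_mul, Matrix.trace_add, Complex.add_re]
  linarith

/-- McCarthy's inequality combined with the scalar bound `(x + y)^q ≤ 2^(q-1) (x^q + y^q)`. -/
theorem schattenNorm_add_schattenNorm_le (h1 : 1 ≤ p) (h2 : p ≤ 2)
    {X Y : Matrix (Fin n) (Fin n) ℂ} (hX : X.PosSemidef) (hY : Y.PosSemidef) :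
    schattenNorm p X + schattenNorm p Y ≤
      2 ^ (1 - (p⁻¹).toReal) * schattenNorm p (X + Y) := by
  have hp : p ≠ ∞ := (h2.trans_lt (by simp)).ne
  have hp1 := one_le_toReal h1 hp
  have hp2 : p.toReal ≤ 2 := by
    simpa using (ENNReal.toReal_le_toReal hp (by simp)).mpr h2
  rw [schattenNorm_eq_rpow hX hp, schattenNorm_eq_rpow hY hp, schattenNorm_eq_rpow (hX.add hY) hp]
  have hm := trace_rpow_add_le hX hY hp1 hp2
  have ha := trace_rpow_re_nonneg hX p.toReal
  have hb := trace_rpow_re_nonneg hY p.toReal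
  set a := (CFC.rpow X p.toReal).trace.re
  set b := (CFC.rpow Y p.toReal).trace.re
  set q := p.toReal
  have hq : 0 < q := by linarith
  have hpow {x : ℝ} (hx : 0 ≤ x) : (x ^ (1 / q)) ^ q = x := by
    rw [← Real.rpow_mul hx, one_div_mul_cancel hq.ne', Real.rpow_one]
  have hj : (a ^ (1 / q) + b ^ (1 / q)) ^ q ≤
      2 ^ (q - 1) * ((a ^ (1 / q)) ^ q + (b ^ (1 / q)) ^ q) := by
    have h := NNReal.rpow_add_le_mul_rpow_add_rpow ⟨a ^ (1 / q), by positivity⟩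
      ⟨b ^ (1 / q), by positivity⟩ hp1
    exact_mod_cast h
  rw [hpow ha, hpow hb] at hj
  rw [ENNReal.toReal_inv]
  calc a ^ (1 / q) + b ^ (1 / q) = ((a ^ (1 / q) + b ^ (1 / q)) ^ q) ^ (1 / q) := by
        rw [← Real.rpow_mul (by positivity), mul_one_div_cancel hq.ne', Real.rpow_one]
    _ ≤ (2 ^ (q - 1) * (CFC.rpow (X + Y) q).trace.re) ^ (1 / q) := by
        gcongr
        exact hj.trans (by gcongr)
    _ = _ := by
        rw [Real.mul_rpow (by positivity) (trace_rpow_re_nonneg (hX.add hY) _),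
          ← Real.rpow_mul (by norm_num)]
        congr 2
        change (q - 1) * (1 / q) = 1 - q⁻¹
        field_simp

end SchattenNorm

/-! ### Polar decomposition -/

section PolarDecomposition

variable {n : ℕ}

theorem usualModulus_mul_self (A : Matrix (Fin n) (Fin n) ℂ) :
    usualModulus A * usualModulus A = A.conjTranspose * A :=
  CFC.abs_mul_abs A

open scoped Matrix.Norms.L2Operator in
theorem usualModulus_eq_of_mul_self {A P : Matrix (Fin n) (Fin n) ℂ} (hP : P.PosSemidef)
    (h : P * P = A.conjTranspose * A) : usualModulus A = P :=
  CFC.sqrt_unique h hP.nonneg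

/-- Vectors whose Gram matrix is diagonal with entries `d i ^ 2` are the multiples by `d i` of the
vectors of an orthonormal basis. -/
theorem exists_orthonormalBasis_smul {v : Fin n → EuclideanSpace ℂ (Fin n)} {d : Fin n → ℝ}
    (h : ∀ i j, inner ℂ (v i) (v j) = if i = j then ((d i : ℂ)) ^ 2 else 0) :
    ∃ b : OrthonormalBasis (Fin n) ℂ (EuclideanSpace ℂ (Fin n)), ∀ i, v i = (d i : ℂ) • b i := by
  -- Only the nonzero `v i` can be normalised; where `d i = 0` the vector vanishes and any
  -- completion of the basis serves.
  let s : Set (Fin n) := {i | d i ≠ 0}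
  let w : Fin n → EuclideanSpace ℂ (Fin n) := fun i => ((d i : ℂ))⁻¹ • v i
  have hw : Orthonormal ℂ (s.domRestrict w) := by
    rw [orthonormal_iff_ite]
    rintro ⟨i, hi⟩ ⟨j, hj⟩
    have hi' : (d i : ℂ) ≠ 0 := by exact_mod_cast hi
    simp only [Set.domRestrict_apply, w, inner_smul_left, inner_smul_right, h, Subtype.mk.injEq]
    split_ifs with hij
    · subst hij
      simp only [map_inv₀, Complex.conj_ofReal]
      field_simp
    · simp
  obtain ⟨b, hb⟩ := hw.exists_orthonormalBasis_extension_of_card_eq (by simp)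
  refine ⟨b, fun i => ?_⟩
  by_cases hi : d i = 0
  · have : inner ℂ (v i) (v i) = 0 := by rw [h]; simp [hi]
    rw [inner_self_eq_zero.mp this, hi]
    simp
  · have hi' : (d i : ℂ) ≠ 0 := by exact_mod_cast hi
    rw [hb i hi, smul_smul, mul_inv_cancel₀ hi', one_smul]

open Matrix in
/-- **Polar decomposition** with a unitary factor. -/
theorem exists_unitary_mul_usualModulus (A : Matrix (Fin n) (Fin n) ℂ) :
    ∃ U ∈ Matrix.unitaryGroup (Fin n) ℂ, A = U * usualModulus A := by
  set P := usualModulus A with hPdef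
  have hP : P.PosSemidef := usualModulus_posSemidef A
  set V : Matrix (Fin n) (Fin n) ℂ := hP.isHermitian.eigenvectorUnitary.1 with hV
  set d := hP.isHermitian.eigenvalues with hd
  have hVV : Vᴴ * V = 1 := Unitary.coe_star_mul_self hP.isHermitian.eigenvectorUnitary
  have hVV' : V * Vᴴ = 1 := Unitary.coe_mul_star_self hP.isHermitian.eigenvectorUnitary
  have hPV : P = V * diagonal (fun j => (d j : ℂ)) * Vᴴ := by
    conv_lhs => rw [hP.isHermitian.spectral_theorem, Unitary.conjStarAlgAut_apply]
    rfl
  -- The images under `A` of an eigenbasis of `|A|` are orthogonal with lengths `d j`; normalised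
  -- and completed, they form the unitary `B`.
  have hgram : (A * V)ᴴ * (A * V) = diagonal (fun j => (d j : ℂ) ^ 2) := by
    calc (A * V)ᴴ * (A * V) = Vᴴ * (Aᴴ * A) * V := by
          simp only [conjTranspose_mul, Matrix.mul_assoc]
      _ = (Vᴴ * V) * diagonal (fun j => (d j : ℂ)) * (Vᴴ * V) * diagonal (fun j => (d j : ℂ)) *
            (Vᴴ * V) := by
          rw [← usualModulus_mul_self, ← hPdef, hPV]
          simp only [Matrix.mul_assoc]
      _ = _ := by
          rw [hVV]
          simp [diagonal_mul_diagonal, sq]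
  obtain ⟨b, hb⟩ := exists_orthonormalBasis_smul (n := n) (d := d)
    (v := fun i => WithLp.toLp 2 ((A * V).col i)) (by
      intro i j
      have := congr_fun₂ hgram i j
      rw [diagonal_apply] at this
      rw [← this]
      simp [Matrix.mul_apply, PiLp.inner_apply, mul_comm])
  let B : Matrix (Fin n) (Fin n) ℂ := Matrix.of fun i j => b j i
  have hB : B ∈ Matrix.unitaryGroup (Fin n) ℂ := by
    rw [Matrix.mem_unitaryGroup_iff']
    ext i j
    have := orthonormal_iff_ite.mp b.orthonormal i j
    rw [Matrix.one_apply, ← this]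
    simp [B, Matrix.mul_apply, PiLp.inner_apply, mul_comm]
  have hAV : A * V = B * diagonal (fun j => (d j : ℂ)) := by
    ext i j
    have := congr_arg (fun x : EuclideanSpace ℂ (Fin n) => x i) (hb j)
    simpa [B, Matrix.mul_diagonal, mul_comm] using this
  refine ⟨B * Vᴴ, mul_mem hB (Unitary.star_mem hP.isHermitian.eigenvectorUnitary.2), ?_⟩
  calc A = A * V * Vᴴ := by rw [Matrix.mul_assoc, hVV', Matrix.mul_one]
    _ = B * (Vᴴ * V) * diagonal (fun j => (d j : ℂ)) * Vᴴ := by rw [hAV, hVV, Matrix.mul_one]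
    _ = _ := by
      rw [hPV]
      simp only [Matrix.mul_assoc]

theorem usualModulus_conjTranspose_of_polar {A U : Matrix (Fin n) (Fin n) ℂ}
    (hU : U ∈ Matrix.unitaryGroup (Fin n) ℂ) (h : A = U * usualModulus A) :
    usualModulus A.conjTranspose = U * usualModulus A * U.conjTranspose := by
  have hP := usualModulus_posSemidef A
  refine usualModulus_eq_of_mul_self (hP.mul_mul_conjTranspose_same U) ?_
  have hUU : U.conjTranspose * U = 1 := Matrix.mem_unitaryGroup_iff'.mp hU
  set P := usualModulus A
  have hA : A.conjTranspose = P * U.conjTranspose := by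
    rw [h, Matrix.conjTranspose_mul, hP.isHermitian.eq]
  calc _ = U * P * (U.conjTranspose * U) * (P * U.conjTranspose) := by
        simp only [Matrix.mul_assoc]
    _ = _ := by
        rw [hUU, Matrix.mul_one, ← hA, ← h, Matrix.conjTranspose_conjTranspose]

end PolarDecomposition

/-! ### Upper bounds for the constant -/

section UpperBound

variable {m n : ℕ} {p : ℝ≥0∞}

open Matrix

/-- A matrix form of `2ab ≤ t a² + t⁻¹ b²`: with `A = V P`, `P = |A|` and `s = √t`, the expression
is `(s - s⁻¹ Wᴴ V) P (s - s⁻¹ Wᴴ V)ᴴ`. -/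
theorem add_conj_sub_posSemidef (A W : Matrix (Fin n) (Fin n) ℂ) {t : ℝ} (ht : 0 < t) :
    (t • usualModulus A + t⁻¹ • (Wᴴ * usualModulus Aᴴ * W) - (Wᴴ * A + Aᴴ * W)).PosSemidef := by
  obtain ⟨V, hV, hA⟩ := exists_unitary_mul_usualModulus A
  have hP := usualModulus_posSemidef A
  rw [usualModulus_conjTranspose_of_polar hV hA]
  set P := usualModulus A
  have hA' : Aᴴ = P * Vᴴ := by rw [hA, conjTranspose_mul, hP.isHermitian.eq]
  obtain ⟨s, hs, h0, hstar⟩ : ∃ s : ℂ, s * s = t ∧ s ≠ 0 ∧ star s = s :=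
    ⟨(√t : ℝ), by exact_mod_cast Real.mul_self_sqrt ht.le,
      by exact_mod_cast (Real.sqrt_pos.mpr ht).ne', Complex.conj_ofReal _⟩
  have hs' : s⁻¹ * s⁻¹ = (t : ℂ)⁻¹ := by rw [← mul_inv, hs]
  have key := hP.mul_mul_conjTranspose_same
    (s • (1 : Matrix (Fin n) (Fin n) ℂ) - s⁻¹ • (Wᴴ * V))
  convert key using 1
  rw [hA']
  conv_lhs => rw [hA]
  have e1 : (t : ℝ) • P = (t : ℂ) • P := by ext; simp
  have e2 (Q : Matrix (Fin n) (Fin n) ℂ) : t⁻¹ • Q = (t⁻¹ : ℂ) • Q := by ext; simp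
  rw [e1, e2]
  simp only [conjTranspose_sub, conjTranspose_smul, conjTranspose_one, conjTranspose_mul,
    conjTranspose_conjTranspose, Matrix.sub_mul, Matrix.mul_sub, Matrix.smul_mul, Matrix.mul_smul,
    Matrix.one_mul, Matrix.mul_one, smul_sub, smul_smul, star_inv₀, hstar,
    hs, hs', inv_mul_cancel₀ h0, mul_inv_cancel₀ h0, one_smul, Matrix.mul_assoc]
  abel

/-- For the polar factor `W` of `S = ∑ A_k`, both `Wᴴ S` and `Sᴴ W` equal `|S|`. -/
theorem usualModulus_sum_add_self_le (A : Fin m → Matrix (Fin n) (Fin n) ℂ)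
    {W : Matrix (Fin n) (Fin n) ℂ} (hW : W ∈ Matrix.unitaryGroup (Fin n) ℂ)
    (h : ∑ k, A k = W * usualModulus (∑ k, A k)) {t : ℝ} (ht : 0 < t) :
    usualModulus (∑ k, A k) + usualModulus (∑ k, A k) ≤
      t • (∑ k, usualModulus (A k)) + t⁻¹ • (Wᴴ * (∑ k, usualModulus (A k)ᴴ) * W) := by
  have hWW : Wᴴ * W = 1 := Matrix.mem_unitaryGroup_iff'.mp hW
  have hP := usualModulus_posSemidef (∑ k, A k)
  have h1 : Wᴴ * (∑ k, A k) = usualModulus (∑ k, A k) := by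
    conv_lhs => rw [h, ← Matrix.mul_assoc, hWW, Matrix.one_mul]
  have h2 : (∑ k, A k)ᴴ * W = usualModulus (∑ k, A k) := by
    conv_lhs => rw [h, conjTranspose_mul, Matrix.mul_assoc, hWW, Matrix.mul_one,
      hP.isHermitian.eq]
  rw [Matrix.le_iff]
  have hsum := Matrix.posSemidef_sum Finset.univ fun k _ => add_conj_sub_posSemidef (A k) W ht
  rwa [Finset.sum_sub_distrib, Finset.sum_add_distrib, Finset.sum_add_distrib, ← Finset.smul_sum,
    ← Finset.smul_sum, ← Finset.sum_mul, ← Finset.mul_sum, ← Finset.sum_mul, ← Finset.mul_sum,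
    ← conjTranspose_sum, h1, h2] at hsum

theorem symModulus_posSemidef (A : Matrix (Fin n) (Fin n) ℂ) : (symModulus A).PosSemidef :=
  ((usualModulus_posSemidef A).add (usualModulus_posSemidef Aᴴ)).smul (by simp)

/-- Lets the preceding bound be applied to the adjoints with polar factor `Wᴴ`, exchanging the roles
of `∑ |A_k|` and `∑ |A_kᴴ|`. -/
theorem conjTranspose_eq_mul_usualModulus {A W : Matrix (Fin n) (Fin n) ℂ}
    (hW : W ∈ Matrix.unitaryGroup (Fin n) ℂ) (h : A = W * usualModulus A) :
    Aᴴ = Wᴴ * usualModulus Aᴴ := by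
  have hP := usualModulus_posSemidef A
  have hWW : Wᴴ * W = 1 := Matrix.mem_unitaryGroup_iff'.mp hW
  rw [usualModulus_conjTranspose_of_polar hW h, ← Matrix.mul_assoc, ← Matrix.mul_assoc, hWW,
    Matrix.one_mul]
  conv_lhs => rw [h, conjTranspose_mul, hP.isHermitian.eq]

theorem posSemidef_sum_usualModulus (A : Fin m → Matrix (Fin n) (Fin n) ℂ) :
    (∑ k, usualModulus (A k)).PosSemidef :=
  Matrix.posSemidef_sum _ fun _ _ => usualModulus_posSemidef _

theorem posSemidef_sum_symModulus (A : Fin m → Matrix (Fin n) (Fin n) ℂ) :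
    (∑ k, symModulus (A k)).PosSemidef :=
  Matrix.posSemidef_sum _ fun _ _ => symModulus_posSemidef _

theorem sum_usualModulus_add (A : Fin m → Matrix (Fin n) (Fin n) ℂ) :
    ∑ k, usualModulus (A k) + ∑ k, usualModulus (A k)ᴴ = (2 : ℝ) • ∑ k, symModulus (A k) := by
  simp only [symModulus]
  rw [← Finset.smul_sum, Finset.sum_add_distrib]
  ext; simp

theorem schattenNorm_sum_usualModulus_le (h1 : 1 ≤ p) (A : Fin m → Matrix (Fin n) (Fin n) ℂ) :
    schattenNorm p (∑ k, usualModulus (A k) + ∑ k, usualModulus (A k)ᴴ) ≤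
      2 * schattenNorm p (∑ k, symModulus (A k)) := by
  rw [sum_usualModulus_add]
  exact schattenNorm_smul_le h1 (posSemidef_sum_symModulus A) zero_le_two

theorem schattenNorm_symModulus_sum_le (h1 : 1 ≤ p) (A : Fin m → Matrix (Fin n) (Fin n) ℂ)
    {t : ℝ} (ht : 0 < t) :
    schattenNorm p (symModulus (∑ k, A k)) ≤
      t / 2 * schattenNorm p (∑ k, symModulus (A k)) +
        t⁻¹ / 4 * (schattenNorm p (∑ k, usualModulus (A k)) +
          schattenNorm p (∑ k, usualModulus (A k)ᴴ)) := by
  obtain ⟨W, hW, h⟩ := exists_unitary_mul_usualModulus (∑ k, A k)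
  have hle1 := usualModulus_sum_add_self_le A hW h ht
  have hW' : Wᴴ ∈ Matrix.unitaryGroup (Fin n) ℂ := Unitary.star_mem hW
  have hle2 := usualModulus_sum_add_self_le (fun k => (A k)ᴴ) hW'
    (by simpa only [conjTranspose_sum] using conjTranspose_eq_mul_usualModulus hW h) ht
  simp only [← conjTranspose_sum, conjTranspose_conjTranspose] at hle2
  have hY := posSemidef_sum_usualModulus A
  have hX := posSemidef_sum_usualModulus fun k => (A k)ᴴ
  have hH := posSemidef_sum_symModulus A
  have hsum := sum_usualModulus_add A
  set X := ∑ k, usualModulus (A k)ᴴ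
  set Y := ∑ k, usualModulus (A k)
  set H := ∑ k, symModulus (A k)
  set S := ∑ k, A k
  have hXW := hX.conjTranspose_mul_mul_same W
  have hYW := hY.conjTranspose_mul_mul_same Wᴴ
  have hle : symModulus S ≤ (t / 2) • H + ((t⁻¹ / 4) • (Wᴴ * X * W) +
      (t⁻¹ / 4) • ((Wᴴ)ᴴ * Y * Wᴴ)) := by
    -- One factor `1/2` undoes the doubled moduli, the other comes from `symModulus`.
    have h3 := smul_le_smul_of_nonneg_left (add_le_add hle1 hle2)
      (by norm_num : (0 : ℝ) ≤ 1 / 4)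
    convert h3 using 1
    · ext
      simp [symModulus]
      ring
    · have hs : (t / 2) • H = (t / 4) • (Y + X) := by rw [hsum]; module
      rw [hs, conjTranspose_conjTranspose]
      module
  have ht2 : 0 ≤ t / 2 := by positivity
  have ht4 : 0 ≤ t⁻¹ / 4 := by positivity
  have hR := (hXW.smul ht4).add (hYW.smul ht4)
  calc schattenNorm p (symModulus S) ≤ _ :=
        schattenNorm_le_add h1 (hH.smul ht2) hR (symModulus_posSemidef S) hle
    _ ≤ _ := add_le_add (schattenNorm_smul_le h1 hH ht2)
        (schattenNorm_le_add h1 (hXW.smul ht4) (hYW.smul ht4) hR le_rfl)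
    _ ≤ _ := by
        rw [mul_add, add_comm (t⁻¹ / 4 * schattenNorm p Y)]
        gcongr
        · exact (schattenNorm_smul_le h1 hXW ht4).trans
            (mul_le_mul_of_nonneg_left (schattenNorm_conj_unitary_le h1 hX hW) ht4)
        · exact (schattenNorm_smul_le h1 hYW ht4).trans
            (mul_le_mul_of_nonneg_left (schattenNorm_conj_unitary_le h1 hY hW') ht4)

theorem schattenNorm_mono (h1 : 1 ≤ p) {X Y : Matrix (Fin n) (Fin n) ℂ} (hX : X.PosSemidef)
    (h : X ≤ Y) : schattenNorm p X ≤ schattenNorm p Y := by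
  have hY : Y.PosSemidef := (hX.nonneg.trans h).posSemidef
  have h0 := schattenNorm_smul_le h1 (Matrix.PosSemidef.one (n := Fin n) (R := ℂ)) le_rfl
  have := schattenNorm_le_add h1 hY (Matrix.PosSemidef.one.smul (le_refl (0 : ℝ))) hX
    (by simpa using h)
  linarith

theorem sqrt_two_mem_symConstantSet (h1 : 1 ≤ p) : √2 ∈ symConstantSet p m n := by
  intro A
  -- With `‖X‖ + ‖Y‖ ≤ 4‖H‖` the bound is `(t/2 + 1/t) ‖H‖`, minimal at `t = √2`.
  have h := schattenNorm_symModulus_sum_le h1 A (t := √2) (by positivity)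
  have hY := posSemidef_sum_usualModulus A
  have hX := posSemidef_sum_usualModulus fun k => (A k)ᴴ
  have h2 := schattenNorm_sum_usualModulus_le h1 A
  have h3 := schattenNorm_mono h1 hY (le_add_of_nonneg_right hX.nonneg)
  have h4 := schattenNorm_mono h1 hX (le_add_of_nonneg_left hY.nonneg)
  have hs : (√2)⁻¹ = √2 / 2 := by
    rw [eq_comm, div_eq_iff two_ne_zero, ← div_eq_inv_mul, Real.div_sqrt]
  rw [hs] at h
  have : 0 ≤ √2 := by positivity
  nlinarith

theorem two_rpow_mem_symConstantSet (h1 : 1 ≤ p) (hp : p ≤ 2) :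
    2 ^ (1 - (p⁻¹).toReal) ∈ symConstantSet p m n := by
  intro A
  -- With `a = 2^{1-1/p}`, the choice `t = 1` gives the factor `(1 + a)/2 ≤ a`.
  have h := schattenNorm_symModulus_sum_le h1 A one_pos
  have hY := posSemidef_sum_usualModulus A
  have hX := posSemidef_sum_usualModulus fun k => (A k)ᴴ
  have h2 := schattenNorm_sum_usualModulus_le h1 A
  have h3 := schattenNorm_add_schattenNorm_le h1 hp hY hX
  have ha : (1 : ℝ) ≤ 2 ^ (1 - (p⁻¹).toReal) := by
    refine Real.one_le_rpow one_le_two (sub_nonneg.mpr ?_)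
    simpa using (ENNReal.toReal_le_toReal (by simpa using (zero_lt_one.trans_le h1).ne')
      ENNReal.one_ne_top).mpr (ENNReal.inv_le_one.mpr h1)
  have hN := schattenNorm_nonneg p (∑ k, symModulus (A k))
  nlinarith

end UpperBound

/-! ### Norms of diagonal matrices -/

section Diagonal

variable {n : ℕ}

theorem posSemidef_diagonal_ofReal {d : Fin n → ℝ} (hd : 0 ≤ d) :
    (Matrix.diagonal fun i => (d i : ℂ)).PosSemidef :=
  Matrix.PosSemidef.diagonal fun i => by simpa using hd i

theorem schattenNorm_diagonal {d : Fin n → ℝ} (hd : 0 ≤ d) {p : ℝ≥0∞} (hp : p ≠ ∞) :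
    schattenNorm p (Matrix.diagonal fun i => (d i : ℂ)) =
      (∑ i, d i ^ p.toReal) ^ (1 / p.toReal) := by
  have hX := posSemidef_diagonal_ofReal hd
  rw [schattenNorm_eq_rpow hX hp, trace_rpow_re hX]
  congr 1
  -- The eigenvalues match the diagonal only up to order, so the comparison is between multisets of
  -- roots.
  have h1 := hX.isHermitian.roots_charpoly_eq_eigenvalues
  have h2 : (Matrix.diagonal fun i => (d i : ℂ)).charpoly.roots =
      Finset.univ.val.map fun i => (d i : ℂ) := by
    have h := Polynomial.roots_multiset_prod_X_sub_C (Finset.univ.val.map fun i => (d i : ℂ))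
    rw [Multiset.map_map] at h
    rw [Matrix.charpoly_diagonal]
    exact h
  have h := congr_arg (fun s : Multiset ℂ => (s.map fun z => z.re ^ p.toReal).sum)
    (h1.symm.trans h2)
  simp only [Multiset.map_map] at h
  exact h

open scoped Matrix.Norms.L2Operator in
theorem schattenNorm_top_diagonal (d : Fin n → ℂ) :
    schattenNorm ∞ (Matrix.diagonal d) = ‖d‖ := by
  rw [schattenNorm_top, Matrix.l2_opNorm_diagonal]

end Diagonal

/-! ### The extremal pair of rank-one matrices -/

section ExtremalPair

variable {n : ℕ}

open Matrix

/-- For real `u, v` of equal length no normalising factor appears: `(u·u) v vᵀ = (v vᵀ)²`. -/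
theorem usualModulus_vecMulVec {u v : Fin n → ℂ} (hu : star u = u) (hv : star v = v)
    (h : u ⬝ᵥ u = v ⬝ᵥ v) : usualModulus (vecMulVec u v) = vecMulVec v v := by
  have hP : (vecMulVec v v).PosSemidef := by
    simpa [hv] using posSemidef_vecMulVec_self_star v
  refine usualModulus_eq_of_mul_self hP ?_
  rw [conjTranspose_vecMulVec, hu, hv, vecMulVec_mul_vecMulVec, vecMulVec_mul_vecMulVec, h]

theorem symModulus_vecMulVec {u v : Fin n → ℂ} (hu : star u = u) (hv : star v = v)
    (h : u ⬝ᵥ u = v ⬝ᵥ v) :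
    symModulus (vecMulVec u v) = (2 : ℂ)⁻¹ • (vecMulVec v v + vecMulVec u u) := by
  rw [symModulus, usualModulus_vecMulVec hu hv h, conjTranspose_vecMulVec, hu, hv,
    usualModulus_vecMulVec hv hu h.symm]

theorem usualModulus_zero : usualModulus (0 : Matrix (Fin n) (Fin n) ℂ) = 0 :=
  CFC.abs_zero

theorem symModulus_zero : symModulus (0 : Matrix (Fin n) (Fin n) ℂ) = 0 := by
  simp [symModulus, usualModulus_zero]

theorem posSemidef_single_self (i : Fin n) : (single i i (1 : ℂ)).PosSemidef := by
  rw [← diagonal_single]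
  exact PosSemidef.diagonal (by simp [Pi.le_def, Pi.single_apply]; intro j; split_ifs <;> simp)

theorem usualModulus_partial_permutation {a b c d : Fin n} (hac : a ≠ c) (hbd : b ≠ d) :
    usualModulus ((√2 : ℂ) • (single a b 1 + single c d 1)) =
      (√2 : ℂ) • (single b b 1 + single d d 1) := by
  refine usualModulus_eq_of_mul_self
    (((posSemidef_single_self b).add (posSemidef_single_self d)).smul (by simp)) ?_
  simp [Matrix.add_mul, Matrix.mul_add, hac, hac.symm, hbd, hbd.symm, conjTranspose_single]

theorem symModulus_partial_permutation {a b c : Fin n} (hab : a ≠ b) (hac : a ≠ c) :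
    symModulus ((√2 : ℂ) • (single b a 1 + single a c 1)) =
      diagonal fun i => (((Pi.single a √2 + Pi.single b (√2)⁻¹ + Pi.single c (√2)⁻¹ :
        Fin n → ℝ) i : ℝ) : ℂ) := by
  have hct : ((√2 : ℂ) • (single b a (1 : ℂ) + single a c 1))ᴴ =
      (√2 : ℂ) • (single a b 1 + single c a 1) := by
    simp [conjTranspose_single]
  have hs : ((√2 : ℝ) : ℂ)⁻¹ = 2⁻¹ * √2 := by
    have h2 : ((√2 : ℝ) : ℂ) * √2 = 2 := by
      exact_mod_cast Real.mul_self_sqrt (zero_le_two (α := ℝ))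
    have h0 : ((√2 : ℝ) : ℂ) ≠ 0 := by simp
    field_simp
    rw [sq, h2]
  rw [symModulus, hct, usualModulus_partial_permutation hab.symm hac,
    usualModulus_partial_permutation hac hab.symm]
  have hd : (fun i => (((Pi.single a √2 + Pi.single b (√2)⁻¹ + Pi.single c (√2)⁻¹ :
        Fin n → ℝ) i : ℝ) : ℂ)) =
      (√2 : ℂ) • Pi.single a 1 + (2⁻¹ * √2 : ℂ) • Pi.single b 1 +
        (2⁻¹ * √2 : ℂ) • Pi.single c 1 := by
    ext i
    rw [← hs]
    simp only [Pi.add_apply, Pi.smul_apply, Pi.single_apply, smul_eq_mul]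
    push_cast
    split_ifs <;> simp
  rw [hd]
  have hadd (v w : Fin n → ℂ) : diagonal (v + w) = diagonal v + diagonal w :=
    (diagonal_add v w).symm
  rw [hadd, hadd, diagonal_smul, diagonal_smul, diagonal_smul,
    diagonal_single, diagonal_single, diagonal_single]
  ext i j
  simp only [Matrix.smul_apply, Matrix.add_apply, smul_eq_mul]
  ring

/-- Two rank-one matrices for which the symmetric modulus of the sum is as large as possible
relative to the sum of the symmetric moduli. -/
theorem exists_extremal_pair {a b c : Fin n} (hab : a ≠ b) (hac : a ≠ c) :
    ∃ A B : Matrix (Fin n) (Fin n) ℂ,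
      symModulus (A + B) = (diagonal fun i => (((Pi.single a √2 + Pi.single b (√2)⁻¹ +
        Pi.single c (√2)⁻¹ : Fin n → ℝ) i : ℝ) : ℂ)) ∧
      symModulus A + symModulus B = (diagonal fun i => (((Pi.single a 1 + Pi.single b 1 +
        Pi.single c 1 : Fin n → ℝ) i : ℝ) : ℂ)) := by
  set r : ℂ := 2⁻¹ * √2 with hr
  have h2 : ((√2 : ℝ) : ℂ) * √2 = 2 := by
    exact_mod_cast Real.mul_self_sqrt (zero_le_two (α := ℝ))
  have hr2 : r * r = 2⁻¹ := by
    rw [hr]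
    linear_combination (4⁻¹ : ℂ) * h2
  have hrs : (starRingEnd ℂ) r = r := by
    rw [hr, map_mul, Complex.conj_ofReal, map_inv₀, map_ofNat]
  let e : Fin n → Fin n → ℂ := fun i => Pi.single i 1
  have he (i : Fin n) : star (e i) = e i := by simp [e]
  have hrs' : star r = r := hrs
  have hdot (s : ℂ) (i : Fin n) (hi : a ≠ i) (t : ℂ) :
      (s • e a + t • e i) ⬝ᵥ (s • e a + t • e i) = s * s + t * t := by
    simp [e, hi, hi.symm]
  have hsingle (i j k l : Fin n) : single i j (1 : ℂ) k l = e i k * e j l := by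
    rw [single_apply]
    simp only [e, Pi.single_apply]
    split_ifs <;> simp_all
  have hstar (s t : ℂ) (hs : star s = s) (ht : star t = t) (i j : Fin n) :
      star (s • e i + t • e j) = s • e i + t • e j := by
    rw [star_add, star_smul, star_smul, he, he, hs, ht]
  have h1 : star (1 : ℂ) = 1 := star_one _
  have hn1 : star (-1 : ℂ) = -1 := by simp
  have hnr : star (-r) = -r := by rw [star_neg, hrs']
  -- The signs cancel the `aa` and `bc` entries of the sum, leaving `√2 (E_ba + E_ac)`, and cancel
  -- all cross terms among the moduli; `r² = 1/2` makes the `aa` coefficient there `1`.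
  refine ⟨vecMulVec (r • e a + (1 : ℂ) • e b) (r • e a + (1 : ℂ) • e c),
    vecMulVec ((-r) • e a + (1 : ℂ) • e b) (r • e a + (-1 : ℂ) • e c), ?_, ?_⟩
  · rw [← symModulus_partial_permutation hab hac]
    congr 1
    ext i j
    simp only [vecMulVec_apply, Matrix.add_apply, Matrix.smul_apply, Pi.add_apply, Pi.smul_apply,
      smul_eq_mul, hsingle]
    rw [hr]
    ring
  · rw [symModulus_vecMulVec (hstar _ _ hrs' h1 _ _) (hstar _ _ hrs' h1 _ _)
        (by rw [hdot _ _ hab, hdot _ _ hac]),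
      symModulus_vecMulVec (hstar _ _ hnr h1 _ _) (hstar _ _ hrs' hn1 _ _)
        (by rw [hdot _ _ hab, hdot _ _ hac]; ring)]
    have hd : (diagonal fun i => (((Pi.single a 1 + Pi.single b 1 +
        Pi.single c 1 : Fin n → ℝ) i : ℝ) : ℂ)) =
        single a a (1 : ℂ) + single b b 1 + single c c 1 := by
      simp only [← diagonal_single, diagonal_add]
      congr 1
      ext i
      simp only [Pi.add_apply, Pi.single_apply]
      split_ifs <;> norm_num
    rw [hd]
    ext i j
    simp only [vecMulVec_apply, Matrix.add_apply, Matrix.smul_apply, Pi.add_apply, Pi.smul_apply,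
      smul_eq_mul, hsingle]
    linear_combination (2 * e a i * e a j) * hr2

/-- `p ≠ 0` is needed because `0 ^ 0 = 1` would count the zero entries. -/
theorem sum_single_three_rpow {a b c : Fin n} (hab : a ≠ b) (hac : a ≠ c) (hbc : b ≠ c)
    (x y z : ℝ) {p : ℝ} (hp : p ≠ 0) :
    ∑ i, (Pi.single a x + Pi.single b y + Pi.single c z : Fin n → ℝ) i ^ p =
      x ^ p + y ^ p + z ^ p := by
  have h (i : Fin n) : (Pi.single a x + Pi.single b y + Pi.single c z : Fin n → ℝ) i ^ p =
      (Pi.single a (x ^ p) : Fin n → ℝ) i + (Pi.single b (y ^ p) : Fin n → ℝ) i +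
        (Pi.single c (z ^ p) : Fin n → ℝ) i := by
    simp only [Pi.add_apply, Pi.single_apply]
    split_ifs <;> simp_all [Real.zero_rpow]
  rw [Finset.sum_congr rfl fun i _ => h i]
  simp [Finset.sum_add_distrib]

end ExtremalPair

/-! ### The lower bound as a function of `p` -/

section LowerBoundFunction

theorem symLowerBound_two : symLowerBound 2 = 1 := by
  norm_num [symLowerBound]

theorem symLowerBound_le_one {p : ℝ} (h1 : 1 ≤ p) (h2 : p ≤ 2) : symLowerBound p ≤ 1 := by
  have hx1 : (1 : ℝ) ≤ 2 ^ (p / 2) := Real.one_le_rpow one_le_two (by linarith)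
  have hx2 : (2 : ℝ) ^ (p / 2) ≤ 2 := by
    simpa using Real.rpow_le_rpow_of_exponent_le one_le_two (by linarith : p / 2 ≤ 1)
  have hy : (2 : ℝ) ^ (1 - p / 2) = 2 / 2 ^ (p / 2) := by
    rw [Real.rpow_sub two_pos, Real.rpow_one]
  refine Real.rpow_le_one (by positivity) ?_ (by positivity)
  rw [hy, div_le_one (by norm_num), ← sub_nonneg]
  -- With `x = 2^(p/2) ∈ [1, 2]`, the claim `x + 2/x ≤ 3` is `(2 - x)(x - 1) ≥ 0`.
  have : 3 - ((2 : ℝ) ^ (p / 2) + 2 / 2 ^ (p / 2)) =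
      (2 - 2 ^ (p / 2)) * (2 ^ (p / 2) - 1) / 2 ^ (p / 2) := by
    field_simp
    ring
  rw [this]
  exact div_nonneg (mul_nonneg (by linarith) (by linarith)) (by linarith)

/-- Exhibits the `p`-power mean of `√2` and `1/√2` with weights `1/3` and `2/3`; strict monotonicity
then follows from strict convexity of `x ↦ x^(q/p)`. -/
theorem symLowerBound_eq_mean (p : ℝ) :
    symLowerBound p =
      ((1 / 3 : ℝ) * 2 ^ (p / 2) + (2 / 3 : ℝ) * 2 ^ (-(p / 2))) ^ (1 / p) := by
  rw [symLowerBound, sub_eq_add_neg, Real.rpow_add two_pos, Real.rpow_one]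
  ring_nf

theorem symLowerBound_strictMonoOn : StrictMonoOn symLowerBound (Set.Ici 2) := by
  intro p hp q hq hpq
  have hp0 : 0 < p := two_pos.trans_le hp
  have hq0 : 0 < q := two_pos.trans_le hq
  have hr : 1 < q / p := (one_lt_div hp0).mpr hpq
  have hne : (2 : ℝ) ^ (p / 2) ≠ 2 ^ (-(p / 2)) :=
    (Real.rpow_lt_rpow_of_exponent_lt one_lt_two (by linarith)).ne'
  have h := (strictConvexOn_rpow hr).2
    (Set.mem_Ici.mpr (by positivity)) (Set.mem_Ici.mpr (by positivity)) hne
    (show (0 : ℝ) < 1 / 3 by norm_num) (show (0 : ℝ) < 2 / 3 by norm_num) (by norm_num)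
  simp only [smul_eq_mul] at h
  have e1 : p / 2 * (q / p) = q / 2 := by field_simp
  have e2 : -(p / 2) * (q / p) = -(q / 2) := by field_simp
  rw [← Real.rpow_mul two_pos.le, ← Real.rpow_mul two_pos.le, e1, e2] at h
  rw [symLowerBound_eq_mean, symLowerBound_eq_mean]
  have h' := Real.rpow_lt_rpow (by positivity) h (by positivity : 0 < 1 / q)
  rw [← Real.rpow_mul (by positivity)] at h'
  have e3 : q / p * (1 / q) = 1 / p := by field_simp
  rwa [e3] at h'

theorem sqrt_two_eq_rpow {p : ℝ} (hp : 0 < p) : √2 = ((2 : ℝ) ^ (p / 2)) ^ (1 / p) := by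
  rw [← Real.rpow_mul two_pos.le, Real.sqrt_eq_rpow]
  congr 1
  field_simp

theorem tendsto_symLowerBound : Filter.Tendsto symLowerBound Filter.atTop (𝓝 √2) := by
  have hlow : Filter.Tendsto (fun p : ℝ => √2 * (1 / 3 : ℝ) ^ (1 / p)) Filter.atTop (𝓝 √2) := by
    have h0 : Filter.Tendsto (fun p : ℝ => 1 / p) Filter.atTop (𝓝 0) := by
      simpa using tendsto_inv_atTop_zero (𝕜 := ℝ)
    have h1 := (tendsto_const_nhds (x := (1 / 3 : ℝ))).rpow h0 (Or.inl (by norm_num))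
    simpa using h1.const_mul √2
  -- A weighted mean lies below its larger value `√2` and above the contribution of that value
  -- alone.
  refine tendsto_of_tendsto_of_tendsto_of_le_of_le' hlow tendsto_const_nhds ?_ ?_
  · filter_upwards [Filter.eventually_gt_atTop 0] with p hp
    rw [sqrt_two_eq_rpow hp, ← Real.mul_rpow (by positivity) (by positivity),
      symLowerBound_eq_mean]
    gcongr
    have : (0 : ℝ) < 2 ^ (-(p / 2)) := by positivity
    linarith
  · filter_upwards [Filter.eventually_gt_atTop 0] with p hp
    rw [sqrt_two_eq_rpow hp, symLowerBound_eq_mean]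
    gcongr
    have : (2 : ℝ) ^ (-(p / 2)) ≤ 2 ^ (p / 2) :=
      Real.rpow_le_rpow_of_exponent_le one_le_two (by linarith)
    linarith

end LowerBoundFunction

/-! ### The optimal constant -/

section OptimalConstant

variable {m n : ℕ} {p : ℝ≥0∞}

theorem schattenNorm_one_pos (hn : 1 ≤ n) (p : ℝ≥0∞) :
    0 < schattenNorm p (1 : Matrix (Fin n) (Fin n) ℂ) := by
  have : Nonempty (Fin n) := ⟨⟨0, hn⟩⟩
  by_cases hp : p = ∞
  · subst hp
    rw [← Matrix.diagonal_one, schattenNorm_top_diagonal]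
    simp [Pi.norm_def]
  · have h := schattenNorm_diagonal (n := n) (d := fun _ => 1) (fun _ => zero_le_one) hp
    simp only [Complex.ofReal_one, Matrix.diagonal_one] at h
    rw [h]
    simp only [Real.one_rpow, Finset.sum_const, Finset.card_univ, Fintype.card_fin, nsmul_eq_mul,
      mul_one]
    have : (0 : ℝ) < n := by exact_mod_cast hn
    positivity

theorem usualModulus_one : usualModulus (1 : Matrix (Fin n) (Fin n) ℂ) = 1 :=
  usualModulus_of_posSemidef Matrix.PosSemidef.one

theorem symModulus_one : symModulus (1 : Matrix (Fin n) (Fin n) ℂ) = 1 := by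
  rw [symModulus, Matrix.conjTranspose_one, usualModulus_one, ← two_smul ℂ, smul_smul]
  simp

theorem one_le_of_mem_symConstantSet (hm : 1 ≤ m) (hn : 1 ≤ n) {c : ℝ}
    (hc : c ∈ symConstantSet p m n) : 1 ≤ c := by
  have h := hc (Pi.single ⟨0, hm⟩ 1)
  have hs : ∑ k, symModulus ((Pi.single ⟨0, hm⟩ 1 : Fin m → Matrix (Fin n) (Fin n) ℂ) k) = 1 := by
    rw [Finset.sum_eq_single ⟨0, hm⟩]
    · rw [Pi.single_eq_same, symModulus_one]
    · intro k _ hk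
      rw [Pi.single_eq_of_ne hk, symModulus_zero]
    · simp
  rw [hs, Finset.sum_pi_single' _ _ _, if_pos (Finset.mem_univ _), symModulus_one] at h
  exact (le_mul_iff_one_le_left (schattenNorm_one_pos hn p)).mp h

/-- Closedness makes the infimum attained. -/
theorem isClosed_symConstantSet (p : ℝ≥0∞) (m n : ℕ) : IsClosed (symConstantSet p m n) := by
  simp only [symConstantSet, Set.ofPred_forall]
  exact isClosed_iInter fun A => isClosed_le continuous_const (by fun_prop)

theorem bddBelow_symConstantSet (hm : 1 ≤ m) (hn : 1 ≤ n) : BddBelow (symConstantSet p m n) :=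
  ⟨1, fun _ hc => one_le_of_mem_symConstantSet hm hn hc⟩

theorem isLeast_symConstant (hm : 1 ≤ m) (hn : 1 ≤ n) (h1 : 1 ≤ p) :
    IsLeast (symConstantSet p m n) (symConstant p m n) :=
  ⟨(isClosed_symConstantSet p m n).csInf_mem ⟨_, sqrt_two_mem_symConstantSet h1⟩
    (bddBelow_symConstantSet hm hn), fun _ hc => csInf_le (bddBelow_symConstantSet hm hn) hc⟩

theorem symConstant_le_min (hm : 1 ≤ m) (hn : 1 ≤ n) (h1 : 1 ≤ p) :
    symConstant p m n ≤ min ((2 : ℝ) ^ (1 - (p⁻¹).toReal)) √2 := by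
  have hL := isLeast_symConstant hm hn h1
  have hs := hL.2 (sqrt_two_mem_symConstantSet h1)
  refine le_min ?_ hs
  rcases le_total p 2 with hp | hp
  · exact hL.2 (two_rpow_mem_symConstantSet h1 hp)
  -- For `p ≥ 2` the minimum is `√2`, since `1 - 1/p ≥ 1/2`.
  · refine hs.trans ?_
    rw [Real.sqrt_eq_rpow]
    refine Real.rpow_le_rpow_of_exponent_le one_le_two ?_
    have : (p⁻¹).toReal ≤ 1 / 2 := by
      simpa using (ENNReal.toReal_le_toReal (by simpa using (zero_lt_one.trans_le h1).ne')
        (by simp)).mpr (ENNReal.inv_le_inv.mpr hp)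
    linarith

/-- A member of the constant set controls the extremal pair. -/
theorem schattenNorm_extremal_le {c : ℝ} (hm : 2 ≤ m) (hc : c ∈ symConstantSet p m n)
    {i j k : Fin n} (hij : i ≠ j) (hik : i ≠ k) :
    schattenNorm p (Matrix.diagonal fun l => (((Pi.single i √2 + Pi.single j (√2)⁻¹ +
        Pi.single k (√2)⁻¹ : Fin n → ℝ) l : ℝ) : ℂ)) ≤
      c * schattenNorm p (Matrix.diagonal fun l => (((Pi.single i 1 + Pi.single j 1 +
        Pi.single k 1 : Fin n → ℝ) l : ℝ) : ℂ)) := by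
  obtain ⟨l, rfl⟩ := Nat.exists_eq_add_of_le' hm
  obtain ⟨A, B, h1, h2⟩ := exists_extremal_pair hij hik
  -- Padding by zeros reduces every `m ≥ 2` to two matrices.
  have h := hc (Fin.cons A (Fin.cons B fun _ => 0))
  simp only [Fin.sum_univ_succ, Fin.cons_zero, Fin.cons_succ, symModulus_zero,
    Finset.sum_const_zero, add_zero] at h
  rwa [h1, h2] at h

theorem sqrt_two_le_of_mem_symConstantSet {c : ℝ} (hm : 2 ≤ m) (hn : 3 ≤ n)
    (hc : c ∈ symConstantSet ∞ m n) : √2 ≤ c := by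
  have h := schattenNorm_extremal_le hm hc (i := ⟨0, by omega⟩) (j := ⟨1, by omega⟩)
    (k := ⟨2, by omega⟩) (by simp) (by simp)
  have hc1 := one_le_of_mem_symConstantSet (by omega) (by omega) hc
  rw [schattenNorm_top_diagonal, schattenNorm_top_diagonal] at h
  have hl := norm_le_pi_norm (fun l => (((Pi.single (⟨0, by omega⟩ : Fin n) √2 +
    Pi.single ⟨1, by omega⟩ (√2)⁻¹ + Pi.single ⟨2, by omega⟩ (√2)⁻¹ : Fin n → ℝ) l : ℝ) : ℂ))
    ⟨0, by omega⟩
  have hr : ‖fun l => (((Pi.single (⟨0, by omega⟩ : Fin n) 1 + Pi.single ⟨1, by omega⟩ 1 +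
    Pi.single ⟨2, by omega⟩ 1 : Fin n → ℝ) l : ℝ) : ℂ)‖ ≤ 1 := by
    refine (pi_norm_le_iff_of_nonneg zero_le_one).mpr fun l => ?_
    simp only [Pi.add_apply, Pi.single_apply, Fin.ext_iff]
    split_ifs <;> first | omega | simp
  have he : ‖(((Pi.single (⟨0, by omega⟩ : Fin n) √2 + Pi.single ⟨1, by omega⟩ (√2)⁻¹ +
      Pi.single ⟨2, by omega⟩ (√2)⁻¹ : Fin n → ℝ) ⟨0, by omega⟩ : ℝ) : ℂ)‖ = √2 := by
    simp
  nlinarith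

theorem symLowerBound_le_of_mem_symConstantSet {c q : ℝ} (hm : 2 ≤ m) (hn : 3 ≤ n) (hq : 1 ≤ q)
    (hc : c ∈ symConstantSet (ENNReal.ofReal q) m n) : symLowerBound q ≤ c := by
  have hq0 : 0 < q := by linarith
  have hij : (⟨0, by omega⟩ : Fin n) ≠ ⟨1, by omega⟩ := by simp
  have hik : (⟨0, by omega⟩ : Fin n) ≠ ⟨2, by omega⟩ := by simp
  have hjk : (⟨1, by omega⟩ : Fin n) ≠ ⟨2, by omega⟩ := by simp
  have h := schattenNorm_extremal_le hm hc hij hik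
  have hnn {x y z : ℝ} (hx : 0 ≤ x) (hy : 0 ≤ y) (hz : 0 ≤ z) (i j k : Fin n) :
      (0 : Fin n → ℝ) ≤ Pi.single i x + Pi.single j y + Pi.single k z :=
    add_nonneg (add_nonneg (Pi.single_nonneg.mpr hx) (Pi.single_nonneg.mpr hy))
      (Pi.single_nonneg.mpr hz)
  rw [schattenNorm_diagonal (hnn (by positivity) (by positivity) (by positivity) _ _ _)
      ENNReal.ofReal_ne_top,
    schattenNorm_diagonal (hnn zero_le_one zero_le_one zero_le_one _ _ _) ENNReal.ofReal_ne_top,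
    ENNReal.toReal_ofReal hq0.le, sum_single_three_rpow hij hik hjk _ _ _ hq0.ne',
    sum_single_three_rpow hij hik hjk _ _ _ hq0.ne', Real.one_rpow] at h
  have hs : √2 ^ q = 2 ^ (q / 2) := by
    rw [Real.sqrt_eq_rpow, ← Real.rpow_mul two_pos.le]
    congr 1
    ring
  rw [Real.inv_rpow (by positivity), hs, ← Real.rpow_neg two_pos.le,
    ← div_le_iff₀ (by positivity), ← Real.div_rpow (by positivity) (by positivity)] at h
  rw [symLowerBound_eq_mean]
  have he : (1 / 3 : ℝ) * 2 ^ (q / 2) + (2 / 3 : ℝ) * 2 ^ (-(q / 2)) =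
      (2 ^ (q / 2) + 2 ^ (-(q / 2)) + 2 ^ (-(q / 2))) / (1 + 1 + 1) := by
    ring
  rwa [he]

end OptimalConstant

theorem mainTheorem12 :
    (∀ m n : ℕ, 1 ≤ m → 1 ≤ n →
      (∀ p : ℝ≥0∞, 1 ≤ p → IsLeast (symConstantSet p m n) (symConstant p m n)) ∧
      symConstant 1 m n = 1 ∧
      (2 ≤ m → 3 ≤ n → symConstant ∞ m n = Real.sqrt 2) ∧
      (∀ p : ℝ≥0∞, 1 ≤ p →
        symConstant p m n ≤ min ((2 : ℝ) ^ (1 - (p⁻¹).toReal)) (Real.sqrt 2)) ∧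
      (∀ p : ℝ, 1 ≤ p → (p ≤ 2 ∨ (2 ≤ m ∧ 3 ≤ n)) →
        symLowerBound p ≤ symConstant (ENNReal.ofReal p) m n)) ∧
    symLowerBound 2 = 1 ∧
    StrictMonoOn symLowerBound (Set.Ici 2) ∧
    Filter.Tendsto symLowerBound Filter.atTop (𝓝 (Real.sqrt 2)) := by
  refine ⟨fun m n hm hn => ⟨fun p hp => isLeast_symConstant hm hn hp, ?_, fun hm2 hn3 => ?_,
    fun p hp => symConstant_le_min hm hn hp, fun p hp h => ?_⟩, symLowerBound_two,
    symLowerBound_strictMonoOn, tendsto_symLowerBound⟩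
  · refine le_antisymm ?_ (one_le_of_mem_symConstantSet hm hn (isLeast_symConstant hm hn le_rfl).1)
    simpa using (symConstant_le_min hm hn (p := 1) le_rfl).trans (min_le_left _ _)
  · exact le_antisymm ((symConstant_le_min hm hn le_top).trans (min_le_right _ _))
      (sqrt_two_le_of_mem_symConstantSet hm2 hn3 (isLeast_symConstant hm hn le_top).1)
  · have hmem := (isLeast_symConstant hm hn (ENNReal.one_le_ofReal.mpr hp)).1
    rcases h with h | ⟨hm2, hn3⟩
    · exact (symLowerBound_le_one hp h).trans (one_le_of_mem_symConstantSet hm hn hmem)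
    · exact symLowerBound_le_of_mem_symConstantSet hm2 hn3 hp hmem
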